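/- For $\lambda\in(0,\tfrac12)$ and $x\in\mathbb{R}$ let $$\varphi_\lambda(x)=\int_0^{\infty} y^{-2\lambda}\exp\Bigl(-\frac{(y-x)^2}{2}\Bigr)\,dy .$$ For every $\lambda\in(0,\tfrac12)$ there is a unique $x_1^\lambda<0$ with $\varphi_\lambda''(x_1^\lambda)=0$, and a unique $z^\lambda>0$ with $\varphi_\lambda''(z^\lambda)+\varphi_\lambda''(-z^\lambda)=0$. Put $$\sigma_\lambda:=-\frac{x_1^\lambda}{z^\lambda}.$$ Then $\lambda\mapsto\sigma_\lambda$ is continuous and strictly increasing on $(0,\tfrac12)$, and $$\lim_{\lambda\to0^+}\sigma_\lambda=0,\qquad \lim_{\lambda\to\frac12^-}\sigma_\lambda=1 .$$ -/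

import Mathlib

open Set Filter Topology

noncomputable section

/-- The function `φ_λ(x) = ∫₀^∞ y^{-2λ} exp(-(y - x)² / 2) dy`. -/
def varphi (lam x : ℝ) : ℝ :=
  ∫ y in Ioi (0 : ℝ), y ^ (-2 * lam) * Real.exp (-(y - x) ^ 2 / 2)

/-- The second derivative `φ_λ''(x)`. -/
def varphiDD (lam x : ℝ) : ℝ :=
  iteratedDeriv 2 (varphi lam) x

/-- `x` is a negative zero of `φ_λ''`. -/
def IsXOne (lam x : ℝ) : Prop :=
  x < 0 ∧ varphiDD lam x = 0

/-- `z` is a positive zero of the even function `x ↦ φ_λ''(x) + φ_λ''(-x)`. -/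
def IsZ (lam z : ℝ) : Prop :=
  0 < z ∧ varphiDD lam z + varphiDD lam (-z) = 0

/-- The constant `x₁^λ`: the negative zero of `φ_λ''`. -/
def xOneLam (lam : ℝ) : ℝ :=
  Classical.epsilon (IsXOne lam)

/-- The constant `z^λ`: the positive zero of `x ↦ φ_λ''(x) + φ_λ''(-x)`. -/
def zLam (lam : ℝ) : ℝ :=
  Classical.epsilon (IsZ lam)

/-- The constant `σ_λ = -x₁^λ / z^λ`. -/
def sigmaLam (lam : ℝ) : ℝ :=
  -xOneLam lam / zLam lam

end

/-! Put p = 2λ. Up to the positive factor exp(-x²/2), φ_λ'' is `curvature p`, a combination of the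
two moments of order -p and 1 - p. It is strictly decreasing on x ≤ 0, and its even part is strictly
increasing on z ≥ 0, so both roots are unique and their positions are read off from signs at fixed
points.

Monotonicity of σ splits. The root x₁ does not increase with λ because the kernel (y - x)² - 1
changes sign only once on y > 0 (`curvature_le_mul`). The root z strictly decreases by a Sturm
comparison for the ODE solved by the even part (`evenCurvature_pos_of_root`).

Continuity and limits follow from pointwise convergence in p. As p → 0, x₁ → 0 while z stays bounded
below. As p → 1, the measure (1 - p) y^(-p) dy concentrates at 0, so (1 - p) `curvature p x` → x² -
1, whence x₁ → -1 and z → 1. -/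

/-! ### Gaussian moments: regularity and recurrence -/

/-- The moment `∫₀^∞ y^s exp(-y²/2 + xy) dy`. -/
noncomputable def gaussMoment (s x : ℝ) : ℝ :=
  ∫ y in Ioi (0 : ℝ), y ^ s * Real.exp (-y ^ 2 / 2 + x * y)

theorem integrableOn_gaussMoment {s : ℝ} (hs : -1 < s) (x : ℝ) :
    MeasureTheory.IntegrableOn (fun y : ℝ => y ^ s * Real.exp (-y ^ 2 / 2 + x * y)) (Ioi 0) := by
  -- Half of the Gaussian absorbs the linear term: xy ≤ x² + y²/4.
  have h := (integrableOn_rpow_mul_exp_neg_mul_sq (b := 1 / 4) (by norm_num) hs).const_mul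
    (Real.exp (x ^ 2))
  refine MeasureTheory.Integrable.mono' h ?_ ?_
  · refine ContinuousOn.aestronglyMeasurable ?_ measurableSet_Ioi
    refine ContinuousOn.mul (fun y hy => ?_) (by fun_prop)
    exact (Real.continuousAt_rpow_const _ _ (Or.inl (ne_of_gt hy))).continuousWithinAt
  · refine MeasureTheory.ae_restrict_of_forall_mem measurableSet_Ioi fun y hy => ?_
    have hy' : 0 < y := hy
    have h1 : 0 ≤ y ^ s := Real.rpow_nonneg hy'.le s
    rw [Real.norm_of_nonneg (by positivity)]
    have : Real.exp (-y ^ 2 / 2 + x * y) ≤ Real.exp (x ^ 2) * Real.exp (-(1 / 4) * y ^ 2) := by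
      rw [← Real.exp_add]
      exact Real.exp_le_exp.2 (by nlinarith [sq_nonneg (y / 2 - x)])
    calc _ ≤ y ^ s * (Real.exp (x ^ 2) * Real.exp (-(1 / 4) * y ^ 2)) := by gcongr
      _ = _ := by ring

theorem gaussMoment_pos {s : ℝ} (hs : -1 < s) (x : ℝ) : 0 < gaussMoment s x := by
  refine (MeasureTheory.setIntegral_pos_iff_support_of_nonneg_ae ?_
    (integrableOn_gaussMoment hs x)).2 ?_
  · refine MeasureTheory.ae_restrict_of_forall_mem measurableSet_Ioi fun y hy => ?_
    exact mul_nonneg (Real.rpow_nonneg (le_of_lt hy) s) (Real.exp_nonneg _)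
  · have : Function.support (fun y : ℝ => y ^ s * Real.exp (-y ^ 2 / 2 + x * y)) ∩ Ioi 0
        = Ioi 0 := by
      refine inter_eq_right.2 fun y hy => ?_
      exact (mul_pos (Real.rpow_pos_of_pos hy s) (Real.exp_pos _)).ne'
    rw [this]
    simp

theorem hasDerivAt_gaussMoment {s : ℝ} (hs : -1 < s) (x : ℝ) :
    HasDerivAt (gaussMoment s) (gaussMoment (s + 1) x) x := by
  have hs1 : -1 < s + 1 := by linarith
  refine (hasDerivAt_integral_of_dominated_loc_of_deriv_le
    (μ := MeasureTheory.volume.restrict (Ioi 0))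
    (F := fun x y : ℝ => y ^ s * Real.exp (-y ^ 2 / 2 + x * y))
    (F' := fun x y : ℝ => y ^ (s + 1) * Real.exp (-y ^ 2 / 2 + x * y))
    (bound := fun y : ℝ => y ^ (s + 1) * Real.exp (-y ^ 2 / 2 + (x + 1) * y))
    (Metric.ball_mem_nhds x one_pos) ?_ ?_ ?_ ?_ ?_ ?_).2
  · exact Eventually.of_forall fun t => (integrableOn_gaussMoment hs t).1
  · exact integrableOn_gaussMoment hs x
  · exact (integrableOn_gaussMoment hs1 x).1
  · refine MeasureTheory.ae_restrict_of_forall_mem measurableSet_Ioi fun y hy t ht => ?_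
    have hy' : 0 < y := hy
    have h1 : 0 ≤ y ^ (s + 1) := Real.rpow_nonneg hy'.le _
    rw [Real.norm_of_nonneg (by positivity)]
    have ht' : t ≤ x + 1 := by
      rw [Metric.mem_ball, Real.dist_eq] at ht
      linarith [(abs_lt.1 ht).2]
    gcongr
  · exact integrableOn_gaussMoment hs1 (x + 1)
  · refine MeasureTheory.ae_restrict_of_forall_mem measurableSet_Ioi fun y hy t _ => ?_
    have h : HasDerivAt (fun t : ℝ => -y ^ 2 / 2 + t * y) y t := by
      simpa using ((hasDerivAt_id t).mul_const y).const_add (-y ^ 2 / 2)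
    refine (h.exp.const_mul (y ^ s)).congr_deriv ?_
    rw [Real.rpow_add_one (ne_of_gt hy)]
    ring

theorem continuousAt_gaussMoment_exponent {s : ℝ} (hs : -1 < s) (x : ℝ) :
    ContinuousAt (fun t => gaussMoment t x) s := by
  -- The midpoint of -1 and s is an integrable exponent below s. It dominates on y ≤ 1, and s + 1
  -- dominates on y ≥ 1.
  have ha : -1 < (s - 1) / 2 := by linarith
  have hb : -1 < s + 1 := by linarith
  have hnear : ∀ᶠ t in 𝓝 s, (s - 1) / 2 < t ∧ t < s + 1 :=
    (lt_mem_nhds (by linarith)).and (gt_mem_nhds (by linarith))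
  refine MeasureTheory.continuousAt_of_dominated
    (μ := MeasureTheory.volume.restrict (Ioi 0))
    (bound := fun y : ℝ => y ^ ((s - 1) / 2) * Real.exp (-y ^ 2 / 2 + x * y)
      + y ^ (s + 1) * Real.exp (-y ^ 2 / 2 + x * y)) ?_ ?_ ?_ ?_
  · filter_upwards [hnear] with t ht
    exact (integrableOn_gaussMoment (by linarith [ht.1]) x).1
  · filter_upwards [hnear] with t ht
    refine MeasureTheory.ae_restrict_of_forall_mem measurableSet_Ioi fun y hy => ?_
    have hy' : 0 < y := hy
    rw [Real.norm_of_nonneg (mul_nonneg (Real.rpow_nonneg hy'.le t) (Real.exp_nonneg _)),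
      ← add_mul]
    refine mul_le_mul_of_nonneg_right ?_ (Real.exp_nonneg _)
    have h1 : 0 ≤ y ^ ((s - 1) / 2) := Real.rpow_nonneg hy'.le _
    have h2 : 0 ≤ y ^ (s + 1) := Real.rpow_nonneg hy'.le _
    rcases le_total y 1 with hy1 | hy1
    · linarith [Real.rpow_le_rpow_of_exponent_ge hy' hy1 ht.1.le]
    · linarith [Real.rpow_le_rpow_of_exponent_le hy1 ht.2.le]
  · exact (integrableOn_gaussMoment ha x).add (integrableOn_gaussMoment hb x)
  · refine MeasureTheory.ae_restrict_of_forall_mem measurableSet_Ioi fun y hy => ?_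
    exact (Real.continuousAt_const_rpow (ne_of_gt hy)).mul continuousAt_const

/-- Integrate the derivative of y^(s+1) exp(-y²/2 + xy); the boundary term at 0 vanishes since s + 1
> 0. -/
theorem gaussMoment_add_two {s : ℝ} (hs : -1 < s) (x : ℝ) :
    gaussMoment (s + 2) x = x * gaussMoment (s + 1) x + (s + 1) * gaussMoment s x := by
  have i0 := integrableOn_gaussMoment hs x
  have i1 := integrableOn_gaussMoment (s := s + 1) (by linarith) x
  have i2 := integrableOn_gaussMoment (s := s + 2) (by linarith) x
  set f : ℝ → ℝ := fun y => y ^ (s + 1) * Real.exp (-y ^ 2 / 2 + x * y) with hf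
  set f' : ℝ → ℝ := fun y => (s + 1) * (y ^ s * Real.exp (-y ^ 2 / 2 + x * y))
    + x * (y ^ (s + 1) * Real.exp (-y ^ 2 / 2 + x * y))
    - y ^ (s + 2) * Real.exp (-y ^ 2 / 2 + x * y) with hf'
  have i' : MeasureTheory.IntegrableOn f' (Ioi 0) :=
    ((i0.const_mul (s + 1)).add (i1.const_mul x)).sub i2
  have hd : ∀ y ∈ Ioi (0 : ℝ), HasDerivAt f (f' y) y := by
    intro y hy
    have h : HasDerivAt (fun y : ℝ => -y ^ 2 / 2 + x * y) (-y + x) y := by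
      refine ((((hasDerivAt_id y).pow 2).neg.div_const 2).add
        ((hasDerivAt_id y).const_mul x)).congr_deriv ?_
      simp
      ring
    refine ((Real.hasDerivAt_rpow_const (p := s + 1) (Or.inl (ne_of_gt hy))).mul
      h.exp).congr_deriv ?_
    have e1 : y ^ (s + 1) = y ^ s * y := Real.rpow_add_one (ne_of_gt hy) s
    have e2 : y ^ (s + 2) = y ^ s * y ^ 2 := by
      rw [Real.rpow_add hy, Real.rpow_two]
    simp only [hf', add_sub_cancel_right, e1, e2]
    ring
  have hc : ContinuousWithinAt f (Ici 0) 0 := by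
    refine ContinuousWithinAt.mul ?_ (by fun_prop)
    exact (Real.continuousAt_rpow_const _ _ (Or.inr (by linarith))).continuousWithinAt
  have ht := MeasureTheory.tendsto_zero_of_hasDerivAt_of_integrableOn_Ioi hd i' i1
  have h := MeasureTheory.integral_Ioi_of_hasDerivAt_of_tendsto hc hd i' ht
  have e : ∫ y in Ioi (0 : ℝ), f' y
      = (s + 1) * gaussMoment s x + x * gaussMoment (s + 1) x - gaussMoment (s + 2) x := by
    simp only [hf']
    rw [MeasureTheory.integral_sub (f := fun y : ℝ => (s + 1) *
        (y ^ s * Real.exp (-y ^ 2 / 2 + x * y)) + x * (y ^ (s + 1) * Real.exp (-y ^ 2 / 2 + x * y)))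
        ((i0.const_mul (s + 1)).add (i1.const_mul x)) i2,
      MeasureTheory.integral_add (i0.const_mul (s + 1)) (i1.const_mul x),
      MeasureTheory.integral_const_mul, MeasureTheory.integral_const_mul]
    rfl
  rw [e] at h
  have h0 : f 0 = 0 := by simp [hf, Real.zero_rpow (by linarith : s + 1 ≠ 0)]
  linarith

/-- The borderline case s = -1 of the recurrence, where the boundary term at 0 survives and
contributes 1. -/
theorem gaussMoment_one_sub (x : ℝ) : gaussMoment 1 x - x * gaussMoment 0 x = 1 := by
  have i0 := integrableOn_gaussMoment (s := 0) (by norm_num) x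
  have i1 := integrableOn_gaussMoment (s := 1) (by norm_num) x
  have i0' : MeasureTheory.IntegrableOn (fun y : ℝ => -Real.exp (-y ^ 2 / 2 + x * y)) (Ioi 0) := by
    simpa using i0.neg
  have hd : ∀ y ∈ Ioi (0 : ℝ), HasDerivAt (fun y : ℝ => -Real.exp (-y ^ 2 / 2 + x * y))
      (y ^ (1 : ℝ) * Real.exp (-y ^ 2 / 2 + x * y)
        - x * (y ^ (0 : ℝ) * Real.exp (-y ^ 2 / 2 + x * y))) y := by
    intro y _
    have h : HasDerivAt (fun y : ℝ => -y ^ 2 / 2 + x * y) (-y + x) y := by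
      refine ((((hasDerivAt_id y).pow 2).neg.div_const 2).add
        ((hasDerivAt_id y).const_mul x)).congr_deriv ?_
      simp
      ring
    refine h.exp.neg.congr_deriv ?_
    simp only [Real.rpow_one, Real.rpow_zero]
    ring
  have i' := i1.sub (i0.const_mul x)
  have ht := MeasureTheory.tendsto_zero_of_hasDerivAt_of_integrableOn_Ioi hd i' i0'
  have h := MeasureTheory.integral_Ioi_of_hasDerivAt_of_tendsto
    (Continuous.continuousWithinAt (by fun_prop)) hd i' ht
  rw [MeasureTheory.integral_sub i1 (i0.const_mul x), MeasureTheory.integral_const_mul] at h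
  simpa [gaussMoment] using h

/-! ### The second derivative and its dependence on p -/

/-- The function `exp(x²/2) φ_λ''(x)` for `p = 2λ`. -/
noncomputable def curvature (p x : ℝ) : ℝ :=
  -x * gaussMoment (1 - p) x + (x ^ 2 - p) * gaussMoment (-p) x

theorem varphi_eq (lam x : ℝ) :
    varphi lam x = Real.exp (-x ^ 2 / 2) * gaussMoment (-(2 * lam)) x := by
  rw [varphi, gaussMoment, ← MeasureTheory.integral_const_mul]
  congr 1 with y
  rw [show -(y - x) ^ 2 / 2 = -x ^ 2 / 2 + (-y ^ 2 / 2 + x * y) by ring, Real.exp_add,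
    show -2 * lam = -(2 * lam) by ring]
  ring

theorem hasDerivAt_gaussMoment_neg {p : ℝ} (hp : p < 1) (x : ℝ) :
    HasDerivAt (gaussMoment (-p)) (gaussMoment (1 - p) x) x := by
  have := hasDerivAt_gaussMoment (s := -p) (by linarith) x
  rwa [show -p + 1 = 1 - p by ring] at this

theorem gaussMoment_two_sub {p : ℝ} (hp : p < 1) (x : ℝ) :
    gaussMoment (2 - p) x = x * gaussMoment (1 - p) x + (1 - p) * gaussMoment (-p) x := by
  have := gaussMoment_add_two (s := -p) (by linarith) x
  rwa [show -p + 1 = 1 - p by ring, show -p + 2 = 2 - p by ring] at this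

theorem hasDerivAt_gaussMoment_one_sub {p : ℝ} (hp : p < 1) (x : ℝ) :
    HasDerivAt (gaussMoment (1 - p))
      (x * gaussMoment (1 - p) x + (1 - p) * gaussMoment (-p) x) x := by
  have := hasDerivAt_gaussMoment (s := 1 - p) (by linarith) x
  rwa [show 1 - p + 1 = 2 - p by ring, gaussMoment_two_sub hp] at this

theorem hasDerivAt_exp_neg_sq (x : ℝ) :
    HasDerivAt (fun x : ℝ => Real.exp (-x ^ 2 / 2)) (-x * Real.exp (-x ^ 2 / 2)) x := by
  have h : HasDerivAt (fun y : ℝ => -y ^ 2 / 2) (-x) x := by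
    refine (((hasDerivAt_id x).pow 2).neg.div_const 2).congr_deriv ?_
    simp
    ring
  exact h.exp.congr_deriv (mul_comm _ _)

theorem varphiDD_eq {lam : ℝ} (h : lam < 1 / 2) (x : ℝ) :
    varphiDD lam x = Real.exp (-x ^ 2 / 2) * curvature (2 * lam) x := by
  have hp : 2 * lam < 1 := by linarith
  have e : varphi lam = fun x => Real.exp (-x ^ 2 / 2) * gaussMoment (-(2 * lam)) x :=
    funext (varphi_eq lam)
  have h1 : deriv (varphi lam) = fun x => Real.exp (-x ^ 2 / 2) *
      (gaussMoment (1 - 2 * lam) x - x * gaussMoment (-(2 * lam)) x) := by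
    funext t
    rw [e]
    refine HasDerivAt.deriv ?_
    refine ((hasDerivAt_exp_neg_sq t).mul (hasDerivAt_gaussMoment_neg hp t)).congr_deriv ?_
    ring
  rw [varphiDD, iteratedDeriv_succ, iteratedDeriv_one, h1]
  refine HasDerivAt.deriv ?_
  refine ((hasDerivAt_exp_neg_sq x).mul ((hasDerivAt_gaussMoment_one_sub hp x).sub
    ((hasDerivAt_id x).mul (hasDerivAt_gaussMoment_neg hp x)))).congr_deriv ?_
  simp [curvature]
  ring

theorem hasDerivAt_curvature {p : ℝ} (hp : p < 1) (x : ℝ) :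
    HasDerivAt (curvature p)
      ((1 + p) * (x * gaussMoment (-p) x - gaussMoment (1 - p) x)) x := by
  have h := ((hasDerivAt_id x).neg.mul (hasDerivAt_gaussMoment_one_sub hp x)).add
    ((((hasDerivAt_id x).pow 2).sub_const p).mul (hasDerivAt_gaussMoment_neg hp x))
  refine h.congr_deriv ?_
  simp
  ring

theorem curvature_zero_neg {p : ℝ} (h0 : 0 < p) (h1 : p < 1) : curvature p 0 < 0 := by
  have := gaussMoment_pos (s := -p) (by linarith) 0
  simp only [curvature]
  nlinarith

theorem curvature_neg_one_pos {p : ℝ} (h1 : p < 1) : 0 < curvature p (-1) := by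
  have h := gaussMoment_pos (s := -p) (by linarith) (-1)
  have h' := gaussMoment_pos (s := 1 - p) (by linarith) (-1)
  simp only [curvature]
  nlinarith

theorem continuous_curvature {p : ℝ} (h1 : p < 1) : Continuous (curvature p) :=
  continuous_iff_continuousAt.2 fun x => (hasDerivAt_curvature h1 x).continuousAt

theorem strictAntiOn_curvature {p : ℝ} (h0 : -1 < p) (h1 : p < 1) :
    StrictAntiOn (curvature p) (Iic 0) := by
  refine strictAntiOn_of_deriv_neg (convex_Iic 0) (continuous_curvature h1).continuousOn ?_
  intro x hx
  rw [interior_Iic] at hx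
  have hx' : x < 0 := hx
  have h := gaussMoment_pos (s := -p) (by linarith) x
  have h' := gaussMoment_pos (s := 1 - p) (by linarith) x
  rw [(hasDerivAt_curvature h1 x).deriv]
  have : x * gaussMoment (-p) x < 0 := mul_neg_of_neg_of_pos hx' h
  exact mul_neg_of_pos_of_neg (by linarith) (by linarith)

theorem curvature_eq_integral {p : ℝ} (h1 : p < 1) (x : ℝ) :
    MeasureTheory.IntegrableOn
      (fun y : ℝ => y ^ (-p) * ((y - x) ^ 2 - 1) * Real.exp (-y ^ 2 / 2 + x * y)) (Ioi 0) ∧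
    curvature p x =
      ∫ y in Ioi (0 : ℝ), y ^ (-p) * ((y - x) ^ 2 - 1) * Real.exp (-y ^ 2 / 2 + x * y) := by
  have i0 := (integrableOn_gaussMoment (s := -p) (by linarith) x).const_mul (x ^ 2 - 1)
  have i1 := (integrableOn_gaussMoment (s := 1 - p) (by linarith) x).const_mul (2 * x)
  have i2 := integrableOn_gaussMoment (s := 2 - p) (by linarith) x
  have e : EqOn (fun y : ℝ => y ^ (-p) * ((y - x) ^ 2 - 1) * Real.exp (-y ^ 2 / 2 + x * y))
      (fun y : ℝ => y ^ (2 - p) * Real.exp (-y ^ 2 / 2 + x * y)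
        - 2 * x * (y ^ (1 - p) * Real.exp (-y ^ 2 / 2 + x * y))
        + (x ^ 2 - 1) * (y ^ (-p) * Real.exp (-y ^ 2 / 2 + x * y))) (Ioi 0) := by
    intro y hy
    have e1 : y ^ (1 - p) = y ^ (-p) * y := by
      rw [← Real.rpow_add_one (ne_of_gt hy)]; congr 1; ring
    have e2 : y ^ (2 - p) = y ^ (-p) * y ^ 2 := by
      rw [← Real.rpow_two, ← Real.rpow_add hy]; congr 1; ring
    simp only [e1, e2]
    ring
  refine ⟨((i2.sub i1).add i0).congr_fun e.symm measurableSet_Ioi, ?_⟩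
  rw [MeasureTheory.setIntegral_congr_fun measurableSet_Ioi e,
    MeasureTheory.integral_add (f := fun y : ℝ => y ^ (2 - p) * Real.exp (-y ^ 2 / 2 + x * y)
        - 2 * x * (y ^ (1 - p) * Real.exp (-y ^ 2 / 2 + x * y))) (i2.sub i1) i0,
    MeasureTheory.integral_sub i2 i1,
    MeasureTheory.integral_const_mul, MeasureTheory.integral_const_mul]
  have h := gaussMoment_two_sub h1 x
  simp only [gaussMoment] at h
  rw [h]
  simp only [curvature, gaussMoment]
  ring

/-- The kernel of `curvature` changes sign once, at `y = 1 + x`. -/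
theorem curvature_le_mul {p q x : ℝ} (hpq : p ≤ q) (hq : q < 1) (hx : -1 < x) (hx0 : x < 0) :
    curvature q x ≤ (1 + x) ^ (p - q) * curvature p x := by
  obtain ⟨ip, ep⟩ := curvature_eq_integral (hpq.trans_lt hq) x
  obtain ⟨iq, eq⟩ := curvature_eq_integral hq x
  rw [ep, eq, ← MeasureTheory.integral_const_mul]
  refine MeasureTheory.setIntegral_mono_on iq (ip.const_mul _) measurableSet_Ioi fun y hy => ?_
  have hy' : 0 < y := hy
  have e : y ^ (-q) = y ^ (-p) * y ^ (p - q) := by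
    rw [← Real.rpow_add hy']; congr 1; ring
  have hw : 0 ≤ y ^ (-p) * Real.exp (-y ^ 2 / 2 + x * y) := by positivity
  -- The other zero y = x - 1 of the kernel is negative, and y^(p-q) is nonincreasing, so freezing
  -- it at y = 1 + x helps on both sides.
  have key : y ^ (p - q) * ((y - x) ^ 2 - 1) ≤ (1 + x) ^ (p - q) * ((y - x) ^ 2 - 1) := by
    rcases le_total (1 + x) y with h | h
    · exact mul_le_mul_of_nonneg_right
        (Real.rpow_le_rpow_of_nonpos (by linarith) h (by linarith)) (by nlinarith)
    · exact mul_le_mul_of_nonpos_right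
        (Real.rpow_le_rpow_of_nonpos hy' h (by linarith)) (by nlinarith)
  calc _ = y ^ (-p) * Real.exp (-y ^ 2 / 2 + x * y) * (y ^ (p - q) * ((y - x) ^ 2 - 1)) := by
        rw [e]; ring
    _ ≤ y ^ (-p) * Real.exp (-y ^ 2 / 2 + x * y) * ((1 + x) ^ (p - q) * ((y - x) ^ 2 - 1)) :=
        mul_le_mul_of_nonneg_left key hw
    _ = _ := by ring

theorem continuousAt_curvature_param {p : ℝ} (h1 : p < 1) (x : ℝ) :
    ContinuousAt (fun q => curvature q x) p := by
  have a := (continuousAt_gaussMoment_exponent (s := 1 - p) (by linarith) x).comp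
    (f := fun q : ℝ => 1 - q) (x := p) (by fun_prop)
  have b := (continuousAt_gaussMoment_exponent (s := -p) (by linarith) x).comp
    (f := fun q : ℝ => -q) (x := p) (by fun_prop)
  exact (a.const_mul (-x)).add ((by fun_prop : ContinuousAt (fun q => x ^ 2 - q) p).mul b)

/-- The moment of order -q blows up as q → 1, but the recurrence replaces (1 - q) times it by
moments of orders 2 - q and 1 - q, continuous at q = 1. -/
theorem tendsto_one_sub_mul_curvature (x : ℝ) :
    Tendsto (fun q => (1 - q) * curvature q x) (𝓝[<] 1) (𝓝 (x ^ 2 - 1)) := by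
  have a := (continuousAt_gaussMoment_exponent (s := 2 - 1) (by norm_num) x).comp
    (f := fun q : ℝ => 2 - q) (x := 1) (by fun_prop)
  have b := (continuousAt_gaussMoment_exponent (s := 1 - 1) (by norm_num) x).comp
    (f := fun q : ℝ => 1 - q) (x := 1) (by fun_prop)
  have h := (((by fun_prop : ContinuousAt (fun q => x ^ 2 - q) 1).mul a).sub
    ((by fun_prop : ContinuousAt (fun q : ℝ => x * (1 + x ^ 2 - 2 * q)) 1).mul b)).tendsto
  have e := gaussMoment_one_sub x
  refine ((h.mono_left nhdsWithin_le_nhds).congr' ?_).trans_eq ?_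
  · filter_upwards [self_mem_nhdsWithin] with q hq
    have := gaussMoment_two_sub hq x
    simp only [curvature, Function.comp, Pi.mul_apply, Pi.sub_apply]
    rw [this]
    ring
  · congr 1
    simp only [Function.comp, Pi.mul_apply, Pi.sub_apply]
    norm_num
    linear_combination (x ^ 2 - 1) * e

/-! ### The even part and Sturm comparison -/

/-- Twice the even part of `curvature p`. -/
noncomputable def evenCurvature (p z : ℝ) : ℝ :=
  curvature p z + curvature p (-z)

/-- The derivative of `evenCurvature p` divided by `1 + p`. -/
noncomputable def evenSlope (p z : ℝ) : ℝ :=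
  z * (gaussMoment (-p) z + gaussMoment (-p) (-z))
    - (gaussMoment (1 - p) z - gaussMoment (1 - p) (-z))

theorem hasDerivAt_evenCurvature {p : ℝ} (h1 : p < 1) (z : ℝ) :
    HasDerivAt (evenCurvature p) ((1 + p) * evenSlope p z) z := by
  refine ((hasDerivAt_curvature h1 z).add
    ((hasDerivAt_curvature h1 (-z)).comp z (hasDerivAt_neg z))).congr_deriv ?_
  simp only [evenSlope]
  ring

theorem hasDerivAt_evenSlope {p : ℝ} (h1 : p < 1) (z : ℝ) :
    HasDerivAt (evenSlope p) (p * (gaussMoment (-p) z + gaussMoment (-p) (-z))) z := by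
  refine (((hasDerivAt_id z).mul ((hasDerivAt_gaussMoment_neg h1 z).add
    ((hasDerivAt_gaussMoment_neg h1 (-z)).comp z (hasDerivAt_neg z)))).sub
    ((hasDerivAt_gaussMoment_one_sub h1 z).sub
    ((hasDerivAt_gaussMoment_one_sub h1 (-z)).comp z (hasDerivAt_neg z)))).congr_deriv ?_
  simp
  ring

/-- The last term is the derivative of `evenSlope p`, so this is the ODE T'' = z T' - (1 + p) T
divided by 1 + p. -/
theorem evenCurvature_eq (p z : ℝ) :
    evenCurvature p z =
      z * evenSlope p z - p * (gaussMoment (-p) z + gaussMoment (-p) (-z)) := by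
  simp only [evenCurvature, evenSlope, curvature]
  ring

theorem strictMono_evenSlope {p : ℝ} (h0 : 0 < p) (h1 : p < 1) : StrictMono (evenSlope p) := by
  refine strictMono_of_deriv_pos fun z => ?_
  rw [(hasDerivAt_evenSlope h1 z).deriv]
  have h := gaussMoment_pos (s := -p) (by linarith) z
  have h' := gaussMoment_pos (s := -p) (by linarith) (-z)
  positivity

theorem evenSlope_zero (p : ℝ) : evenSlope p 0 = 0 := by
  simp [evenSlope]

theorem evenSlope_pos {p z : ℝ} (h0 : 0 < p) (h1 : p < 1) (hz : 0 < z) : 0 < evenSlope p z := by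
  simpa [evenSlope_zero] using strictMono_evenSlope h0 h1 hz

theorem continuous_evenCurvature {p : ℝ} (h1 : p < 1) : Continuous (evenCurvature p) :=
  continuous_iff_continuousAt.2 fun x => (hasDerivAt_evenCurvature h1 x).continuousAt

theorem strictMonoOn_evenCurvature {p : ℝ} (h0 : 0 < p) (h1 : p < 1) :
    StrictMonoOn (evenCurvature p) (Ici 0) := by
  refine strictMonoOn_of_deriv_pos (convex_Ici 0) (continuous_evenCurvature h1).continuousOn ?_
  intro x hx
  rw [interior_Ici] at hx
  rw [(hasDerivAt_evenCurvature h1 x).deriv]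
  exact mul_pos (by linarith) (evenSlope_pos h0 h1 hx)

theorem evenCurvature_zero_neg {p : ℝ} (h0 : 0 < p) (h1 : p < 1) : evenCurvature p 0 < 0 := by
  simpa [evenCurvature] using add_neg (curvature_zero_neg h0 h1) (curvature_zero_neg h0 h1)

theorem exists_evenCurvature_pos {p : ℝ} (h0 : 0 < p) (h1 : p < 1) :
    ∃ z, 0 < z ∧ 0 < evenCurvature p z := by
  -- The slope increases, so beyond 1 the function grows at least linearly at rate c.
  set c := (1 + p) * evenSlope p 1
  have hc : 0 < c := mul_pos (by linarith) (evenSlope_pos h0 h1 one_pos)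
  obtain ⟨z, hz1, hz⟩ : ∃ z : ℝ, 1 ≤ z ∧ 0 < evenCurvature p 1 + c * (z - 1) := by
    refine ⟨1 + (|evenCurvature p 1| + 1) / c, by simp; positivity, ?_⟩
    rw [add_sub_cancel_left, mul_div_cancel₀ _ hc.ne']
    linarith [neg_abs_le (evenCurvature p 1)]
  refine ⟨z, by linarith, ?_⟩
  have := (convex_Ici (1 : ℝ)).mul_sub_le_image_sub_of_le_deriv
    (continuous_evenCurvature h1).continuousOn
    (fun x _ => (hasDerivAt_evenCurvature h1 x).differentiableAt.differentiableWithinAt)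
    (C := c) (fun x hx => by
      rw [interior_Ici] at hx
      rw [(hasDerivAt_evenCurvature h1 x).deriv]
      exact mul_le_mul_of_nonneg_left ((strictMono_evenSlope h0 h1).monotone (le_of_lt hx))
        (by linarith)) 1 self_mem_Ici z hz1 hz1
  linarith

/-- Sturm comparison for the even solutions of `T'' = z T' - (1 + p) T`. -/
theorem evenCurvature_pos_of_root {p q z : ℝ} (h0 : 0 < p) (hpq : p < q) (h1 : q < 1)
    (hz : 0 < z) (hpz : evenCurvature p z = 0) : 0 < evenCurvature q z := by
  by_contra! hqz
  have hp1 : p < 1 := hpq.trans h1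
  have hq0 : 0 < q := h0.trans hpq
  -- Wronskian of the two solutions; the weight is the integrating factor removing the first-order
  -- term of the ODE.
  set W : ℝ → ℝ := fun x => Real.exp (-x ^ 2 / 2) *
    ((1 + p) * evenSlope p x * evenCurvature q x - evenCurvature p x * ((1 + q) * evenSlope q x))
    with hW
  have hd : ∀ x, HasDerivAt W (Real.exp (-x ^ 2 / 2) *
      ((q - p) * (evenCurvature p x * evenCurvature q x))) x := by
    intro x
    refine ((hasDerivAt_exp_neg_sq x).mul
      ((((hasDerivAt_evenSlope hp1 x).const_mul (1 + p)).mul (hasDerivAt_evenCurvature h1 x)).sub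
      ((hasDerivAt_evenCurvature hp1 x).mul
        ((hasDerivAt_evenSlope h1 x).const_mul (1 + q))))).congr_deriv ?_
    have ep := evenCurvature_eq p x
    have eq := evenCurvature_eq q x
    simp only [Pi.mul_apply, Pi.sub_apply]
    linear_combination (Real.exp (-x ^ 2 / 2)) * ((1 + p) * evenCurvature q x * ep
      - (1 + q) * evenCurvature p x * eq)
  -- Under `hqz` both functions are negative on [0, z), so W increases strictly from W(0) = 0; yet
  -- W(z) ≤ 0.
  have hmono : StrictMonoOn W (Icc 0 z) := by
    refine strictMonoOn_of_deriv_pos (convex_Icc 0 z)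
      (fun x _ => (hd x).continuousAt.continuousWithinAt) fun x hx => ?_
    rw [interior_Icc] at hx
    rw [(hd x).deriv]
    have hp := strictMonoOn_evenCurvature h0 hp1 hx.1.le hz.le hx.2
    have hq := strictMonoOn_evenCurvature hq0 h1 hx.1.le hz.le hx.2
    exact mul_pos (Real.exp_pos _) (mul_pos (sub_pos.2 hpq)
      (mul_pos_of_neg_of_neg (by linarith) (by linarith)))
  have h := hmono (left_mem_Icc.2 hz.le) (right_mem_Icc.2 hz.le) hz
  simp only [hW, evenSlope_zero, hpz] at h
  have h2 : Real.exp (-z ^ 2 / 2) * ((1 + p) * evenSlope p z * evenCurvature q z) ≤ 0 :=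
    mul_nonpos_of_nonneg_of_nonpos (Real.exp_nonneg _) (mul_nonpos_of_nonneg_of_nonpos
      (mul_nonneg (by linarith) (evenSlope_pos h0 hp1 hz).le) hqz)
  simp at h
  linarith

/-! ### The roots and their location by signs -/

theorem isXOne_iff {lam x : ℝ} (h : lam < 1 / 2) :
    IsXOne lam x ↔ x < 0 ∧ curvature (2 * lam) x = 0 := by
  simp [IsXOne, varphiDD_eq h, Real.exp_ne_zero]

theorem isZ_iff {lam z : ℝ} (h : lam < 1 / 2) :
    IsZ lam z ↔ 0 < z ∧ evenCurvature (2 * lam) z = 0 := by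
  rw [IsZ, varphiDD_eq h, varphiDD_eq h, neg_sq, ← mul_add]
  simp [evenCurvature, Real.exp_ne_zero]

theorem existsUnique_isXOne {lam : ℝ} (h : lam ∈ Ioo (0 : ℝ) (1 / 2)) :
    ∃! x, IsXOne lam x := by
  have h0 : 0 < 2 * lam := by linarith [h.1]
  have h1 : 2 * lam < 1 := by linarith [h.2]
  simp only [isXOne_iff h.2]
  obtain ⟨x, hx, hx'⟩ := intermediate_value_Ioo' (by norm_num : (-1 : ℝ) ≤ 0)
    (continuous_curvature h1).continuousOn ⟨curvature_zero_neg h0 h1, curvature_neg_one_pos h1⟩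
  exact ⟨x, ⟨hx.2, hx'⟩, fun y hy => (strictAntiOn_curvature (by linarith) h1).injOn
    hy.1.le hx.2.le (hy.2.trans hx'.symm)⟩

theorem existsUnique_isZ {lam : ℝ} (h : lam ∈ Ioo (0 : ℝ) (1 / 2)) : ∃! z, IsZ lam z := by
  have h0 : 0 < 2 * lam := by linarith [h.1]
  have h1 : 2 * lam < 1 := by linarith [h.2]
  simp only [isZ_iff h.2]
  obtain ⟨b, hb, hb'⟩ := exists_evenCurvature_pos h0 h1
  obtain ⟨z, hz, hz'⟩ := intermediate_value_Ioo hb.le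
    (continuous_evenCurvature h1).continuousOn ⟨evenCurvature_zero_neg h0 h1, hb'⟩
  exact ⟨z, ⟨hz.1, hz'⟩, fun y hy => (strictMonoOn_evenCurvature h0 h1).injOn
    hy.1.le hz.1.le (hy.2.trans hz'.symm)⟩

theorem xOneLam_spec {lam : ℝ} (h : lam ∈ Ioo (0 : ℝ) (1 / 2)) :
    xOneLam lam < 0 ∧ curvature (2 * lam) (xOneLam lam) = 0 :=
  (isXOne_iff h.2).1 (Classical.epsilon_spec (existsUnique_isXOne h).exists)

theorem zLam_spec {lam : ℝ} (h : lam ∈ Ioo (0 : ℝ) (1 / 2)) :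
    0 < zLam lam ∧ evenCurvature (2 * lam) (zLam lam) = 0 :=
  (isZ_iff h.2).1 (Classical.epsilon_spec (existsUnique_isZ h).exists)

theorem curvature_pos_iff {lam x : ℝ} (h : lam ∈ Ioo (0 : ℝ) (1 / 2)) (hx : x < 0) :
    0 < curvature (2 * lam) x ↔ x < xOneLam lam := by
  obtain ⟨a, b⟩ := xOneLam_spec h
  rw [← b]
  exact (strictAntiOn_curvature (by linarith [h.1]) (by linarith [h.2])).lt_iff_gt a.le hx.le

theorem curvature_neg_iff {lam x : ℝ} (h : lam ∈ Ioo (0 : ℝ) (1 / 2)) (hx : x < 0) :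
    curvature (2 * lam) x < 0 ↔ xOneLam lam < x := by
  obtain ⟨a, b⟩ := xOneLam_spec h
  rw [← b]
  exact (strictAntiOn_curvature (by linarith [h.1]) (by linarith [h.2])).lt_iff_gt hx.le a.le

theorem evenCurvature_pos_iff {lam z : ℝ} (h : lam ∈ Ioo (0 : ℝ) (1 / 2)) (hz : 0 < z) :
    0 < evenCurvature (2 * lam) z ↔ zLam lam < z := by
  obtain ⟨a, b⟩ := zLam_spec h
  rw [← b]
  exact (strictMonoOn_evenCurvature (by linarith [h.1]) (by linarith [h.2])).lt_iff_lt a.le hz.le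

theorem evenCurvature_neg_iff {lam z : ℝ} (h : lam ∈ Ioo (0 : ℝ) (1 / 2)) (hz : 0 < z) :
    evenCurvature (2 * lam) z < 0 ↔ z < zLam lam := by
  obtain ⟨a, b⟩ := zLam_spec h
  rw [← b]
  exact (strictMonoOn_evenCurvature (by linarith [h.1]) (by linarith [h.2])).lt_iff_lt hz.le a.le

theorem neg_one_lt_xOneLam {lam : ℝ} (h : lam ∈ Ioo (0 : ℝ) (1 / 2)) : -1 < xOneLam lam :=
  (curvature_pos_iff h (by norm_num)).1 (curvature_neg_one_pos (by linarith [h.2]))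

/-! ### Monotonicity in λ -/

theorem antitoneOn_xOneLam : AntitoneOn xOneLam (Ioo (0 : ℝ) (1 / 2)) := by
  intro a ha b hb hab
  obtain ⟨h0, h⟩ := xOneLam_spec ha
  by_contra! hlt
  have := (curvature_pos_iff hb h0).2 hlt
  have hle := curvature_le_mul (p := 2 * a) (q := 2 * b) (by linarith) (by linarith [hb.2])
    (neg_one_lt_xOneLam ha) h0
  rw [h, mul_zero] at hle
  linarith

theorem strictAntiOn_zLam : StrictAntiOn zLam (Ioo (0 : ℝ) (1 / 2)) := by
  intro a ha b hb hab
  obtain ⟨h0, h⟩ := zLam_spec ha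
  exact (evenCurvature_pos_iff hb h0).1
    (evenCurvature_pos_of_root (by linarith [ha.1]) (by linarith) (by linarith [hb.2]) h0 h)

theorem strictMonoOn_sigmaLam : StrictMonoOn sigmaLam (Ioo (0 : ℝ) (1 / 2)) := by
  intro a ha b hb hab
  have hx := antitoneOn_xOneLam ha hb hab.le
  have hz := strictAntiOn_zLam ha hb hab
  have hxa := (xOneLam_spec ha).1
  have hzb := (zLam_spec hb).1
  calc -xOneLam a / zLam a < -xOneLam a / zLam b :=
        div_lt_div_of_pos_left (by linarith) hzb hz
    _ ≤ -xOneLam b / zLam b := by gcongr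

/-! ### Continuity and limits -/

/-- A sign-based criterion for the convergence of `xOneLam`. -/
theorem tendsto_xOneLam {l : Filter ℝ} {x₀ : ℝ} (hl : ∀ᶠ t in l, t ∈ Ioo (0 : ℝ) (1 / 2))
    (hx₀ : x₀ ≤ 0) (hlo : ∀ x < x₀, ∀ᶠ t in l, 0 < curvature (2 * t) x)
    (hhi : ∀ x, x₀ < x → x < 0 → ∀ᶠ t in l, curvature (2 * t) x < 0) :
    Tendsto xOneLam l (𝓝 x₀) := by
  refine tendsto_order.2 ⟨fun x hx => ?_, fun x hx => ?_⟩
  · filter_upwards [hl, hlo x hx] with t ht h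
    exact (curvature_pos_iff ht (hx.trans_le hx₀)).1 h
  · rcases lt_or_ge x 0 with h0 | h0
    · filter_upwards [hl, hhi x hx h0] with t ht h
      exact (curvature_neg_iff ht h0).1 h
    · filter_upwards [hl] with t ht
      exact (xOneLam_spec ht).1.trans_le h0

/-- A sign-based criterion for the convergence of `zLam`. -/
theorem tendsto_zLam {l : Filter ℝ} {z₀ : ℝ} (hl : ∀ᶠ t in l, t ∈ Ioo (0 : ℝ) (1 / 2))
    (hz₀ : 0 ≤ z₀) (hlo : ∀ z, 0 < z → z < z₀ → ∀ᶠ t in l, evenCurvature (2 * t) z < 0)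
    (hhi : ∀ z, z₀ < z → ∀ᶠ t in l, 0 < evenCurvature (2 * t) z) :
    Tendsto zLam l (𝓝 z₀) := by
  refine tendsto_order.2 ⟨fun z hz => ?_, fun z hz => ?_⟩
  · rcases lt_or_ge 0 z with h0 | h0
    · filter_upwards [hl, hlo z h0 hz] with t ht h
      exact (evenCurvature_neg_iff ht h0).1 h
    · filter_upwards [hl] with t ht
      exact h0.trans_lt (zLam_spec ht).1
  · filter_upwards [hl, hhi z hz] with t ht h
    exact (evenCurvature_pos_iff ht (hz₀.trans_lt hz)).1 h

theorem tendsto_curvature {lam : ℝ} (h : lam < 1 / 2) (x : ℝ) :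
    Tendsto (fun t => curvature (2 * t) x) (𝓝 lam) (𝓝 (curvature (2 * lam) x)) :=
  (continuousAt_curvature_param (by linarith) x).tendsto.comp
    (by fun_prop : ContinuousAt (fun t : ℝ => 2 * t) lam).tendsto

theorem tendsto_evenCurvature {lam : ℝ} (h : lam < 1 / 2) (z : ℝ) :
    Tendsto (fun t => evenCurvature (2 * t) z) (𝓝 lam) (𝓝 (evenCurvature (2 * lam) z)) :=
  (tendsto_curvature h z).add (tendsto_curvature h (-z))

theorem continuousOn_sigmaLam : ContinuousOn sigmaLam (Ioo (0 : ℝ) (1 / 2)) := by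
  intro lam h
  have hl : ∀ᶠ t in 𝓝 lam, t ∈ Ioo (0 : ℝ) (1 / 2) := isOpen_Ioo.mem_nhds h
  obtain ⟨hx, -⟩ := xOneLam_spec h
  obtain ⟨hz, -⟩ := zLam_spec h
  have cx : Tendsto xOneLam (𝓝 lam) (𝓝 (xOneLam lam)) := tendsto_xOneLam hl hx.le
    (fun x hlt => (tendsto_curvature h.2 x).eventually
      (lt_mem_nhds ((curvature_pos_iff h (hlt.trans hx)).2 hlt)))
    (fun x hlt h0 => (tendsto_curvature h.2 x).eventually
      (gt_mem_nhds ((curvature_neg_iff h h0).2 hlt)))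
  have cz : Tendsto zLam (𝓝 lam) (𝓝 (zLam lam)) := tendsto_zLam hl hz.le
    (fun z h0 hlt => (tendsto_evenCurvature h.2 z).eventually
      (gt_mem_nhds ((evenCurvature_neg_iff h h0).2 hlt)))
    (fun z hlt => (tendsto_evenCurvature h.2 z).eventually
      (lt_mem_nhds ((evenCurvature_pos_iff h (hz.trans hlt)).2 hlt)))
  exact (cx.neg.div cz hz.ne').mono_left nhdsWithin_le_nhds

theorem tendsto_sigmaLam_zero : Tendsto sigmaLam (𝓝[>] (0 : ℝ)) (𝓝 0) := by
  have hl : ∀ᶠ t in 𝓝[>] (0 : ℝ), t ∈ Ioo (0 : ℝ) (1 / 2) := Ioo_mem_nhdsGT (by norm_num)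
  have hl' : ∀ᶠ t in 𝓝[>] (0 : ℝ), t ∈ Ioo (0 : ℝ) (1 / 4) := Ioo_mem_nhdsGT (by norm_num)
  have cx : Tendsto xOneLam (𝓝[>] (0 : ℝ)) (𝓝 0) := by
    refine tendsto_xOneLam hl le_rfl (fun x hx => ?_)
      (fun x h h' => absurd h' h.not_gt)
    refine ((tendsto_curvature (lam := 0) (by norm_num) x).mono_left
      nhdsWithin_le_nhds).eventually (lt_mem_nhds ?_)
    have h1 := gaussMoment_pos (s := 1) (by norm_num) x
    have h0 := gaussMoment_pos (s := 0) (by norm_num) x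
    simp only [curvature, mul_zero, sub_zero, neg_zero]
    have : 0 < -x := by linarith
    positivity
  -- `evenCurvature 0` vanishes identically, so its signs do not locate z near λ = 0. Monotonicity
  -- gives the lower bound z^λ ≥ z^(1/4), which suffices; 1/4 is an arbitrary reference point.
  have hq : (1 / 4 : ℝ) ∈ Ioo (0 : ℝ) (1 / 2) := by constructor <;> norm_num
  have hz := (zLam_spec hq).1
  have c : Tendsto (fun t => -xOneLam t / zLam (1 / 4)) (𝓝[>] (0 : ℝ)) (𝓝 0) := by
    simpa using cx.neg.div_const (zLam (1 / 4))
  refine squeeze_zero' ?_ ?_ c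
  · filter_upwards [hl] with t ht
    exact div_nonneg (by linarith [(xOneLam_spec ht).1]) (zLam_spec ht).1.le
  · filter_upwards [hl, hl'] with t ht ht'
    exact div_le_div_of_nonneg_left (by linarith [(xOneLam_spec ht).1]) hz
      (strictAntiOn_zLam ht hq ht'.2).le

theorem tendsto_one_sub_mul_curvature_half (x : ℝ) :
    Tendsto (fun t => (1 - 2 * t) * curvature (2 * t) x) (𝓝[<] (1 / 2)) (𝓝 (x ^ 2 - 1)) := by
  refine (tendsto_one_sub_mul_curvature x).comp (f := fun t : ℝ => 2 * t)
    (tendsto_nhdsWithin_iff.2 ⟨?_, ?_⟩)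
  · have : Tendsto (fun t : ℝ => 2 * t) (𝓝 (1 / 2)) (𝓝 (2 * (1 / 2))) :=
      Continuous.tendsto (by fun_prop) _
    norm_num at this
    simpa using this.mono_left nhdsWithin_le_nhds
  · filter_upwards [self_mem_nhdsWithin] with t ht
    have : t < 1 / 2 := ht
    show 2 * t < 1
    linarith

theorem tendsto_sigmaLam_half : Tendsto sigmaLam (𝓝[<] (1 / 2 : ℝ)) (𝓝 1) := by
  have hl : ∀ᶠ t in 𝓝[<] (1 / 2 : ℝ), t ∈ Ioo (0 : ℝ) (1 / 2) := Ioo_mem_nhdsLT (by norm_num)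
  have hE : ∀ z, Tendsto (fun t => (1 - 2 * t) * evenCurvature (2 * t) z) (𝓝[<] (1 / 2))
      (𝓝 (2 * (z ^ 2 - 1))) := fun z => by
    convert (tendsto_one_sub_mul_curvature_half z).add
      (tendsto_one_sub_mul_curvature_half (-z)) using 2
    · simp only [evenCurvature]; ring
    · ring
  have hpos : ∀ {t c : ℝ}, t ∈ Ioo (0 : ℝ) (1 / 2) → 0 < (1 - 2 * t) * c → 0 < c :=
    fun ht h => pos_of_mul_pos_right h (by linarith [ht.2])
  have hneg : ∀ {t c : ℝ}, t ∈ Ioo (0 : ℝ) (1 / 2) → (1 - 2 * t) * c < 0 → c < 0 :=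
    fun ht h => neg_of_mul_neg_right h (by linarith [ht.2])
  have cx : Tendsto xOneLam (𝓝[<] (1 / 2 : ℝ)) (𝓝 (-1)) := by
    refine tendsto_xOneLam hl (by norm_num) (fun x hx => ?_) (fun x hx h0 => ?_)
    · filter_upwards [hl, (tendsto_one_sub_mul_curvature_half x).eventually
        (lt_mem_nhds (by nlinarith : (0 : ℝ) < x ^ 2 - 1))] with t ht h
      exact hpos ht h
    · filter_upwards [hl, (tendsto_one_sub_mul_curvature_half x).eventually
        (gt_mem_nhds (by nlinarith : x ^ 2 - 1 < (0 : ℝ)))] with t ht h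
      exact hneg ht h
  have cz : Tendsto zLam (𝓝[<] (1 / 2 : ℝ)) (𝓝 1) := by
    refine tendsto_zLam hl (by norm_num) (fun z h0 hz => ?_) (fun z hz => ?_)
    · filter_upwards [hl, (hE z).eventually
        (gt_mem_nhds (by nlinarith : 2 * (z ^ 2 - 1) < (0 : ℝ)))] with t ht h
      exact hneg ht h
    · filter_upwards [hl, (hE z).eventually
        (lt_mem_nhds (by nlinarith : (0 : ℝ) < 2 * (z ^ 2 - 1)))] with t ht h
      exact hpos ht h
  have := cx.neg.div cz one_ne_zero
  norm_num at this
  exact this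

theorem proposition2109 :
    (∀ lam ∈ Ioo (0 : ℝ) (1 / 2), (∃! x, IsXOne lam x) ∧ (∃! z, IsZ lam z)) ∧
    ContinuousOn sigmaLam (Ioo (0 : ℝ) (1 / 2)) ∧
    StrictMonoOn sigmaLam (Ioo (0 : ℝ) (1 / 2)) ∧
    Tendsto sigmaLam (𝓝[>] (0 : ℝ)) (𝓝 0) ∧
    Tendsto sigmaLam (𝓝[<] (1 / 2 : ℝ)) (𝓝 1) :=
  ⟨fun _ h => ⟨existsUnique_isXOne h, existsUnique_isZ h⟩, continuousOn_sigmaLam,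
    strictMonoOn_sigmaLam, tendsto_sigmaLam_zero, tendsto_sigmaLam_half⟩
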